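/- Notation. Let $n\ge 1$, $J_n=\begin{bmatrix}0&I_n\\-I_n&0\end{bmatrix}$, $\mathcal J=J_n$, and let $A^H$ denote the conjugate transpose. A matrix $\mathcal S\in\mathbb C^{2n\times 2n}$ is symplectic if $\mathcal S\mathcal J\mathcal S^H=\mathcal J$; $\mathcal H\in\mathbb C^{2n\times 2n}$ is Hamiltonian if $\mathcal H\mathcal J=(\mathcal H\mathcal J)^H$. For symplectic $\mathcal S_1,\mathcal S_2$ and $X=[X_{ij}]_{1\le i,j\le 2}$ with $n\times n$ blocks put $$T_{\mathcal S_1,\mathcal S_2}(X)=\left(\begin{bmatrix}X_{12}&0\\X_{22}&I\end{bmatrix}\mathcal S_2,\ \begin{bmatrix}I&X_{11}\\0&X_{21}\end{bmatrix}\mathcal S_1\right).$$ Algorithms. SDA-1 generates $(\mathcal M_k,\mathcal L_k)=\left(\begin{bmatrix}A_k&0\\-H_k&I\end{bmatrix},\begin{bmatrix}I&G_k\\0&A_k^H\end{bmatrix}\right)$ by $A_{k+1}=A_k(I+G_kH_k)^{-1}A_k$, $G_{k+1}=G_k+A_kG_k(I+H_kG_k)^{-1}A_k^H$, $H_{k+1}=H_k+A_k^H(I+H_kG_k)^{-1}H_kA_k$.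 SDA-2 generates $(\mathcal M_k,\mathcal L_k)=\left(\begin{bmatrix}A_k&0\\Q_k&-I\end{bmatrix},\begin{bmatrix}-P_k&I\\A_k^H&0\end{bmatrix}\right)$ by $A_{k+1}=A_k(Q_k-P_k)^{-1}A_k$, $Q_{k+1}=Q_k-A_k^H(Q_k-P_k)^{-1}A_k$, $P_{k+1}=P_k+A_k(Q_k-P_k)^{-1}A_k^H$. Take $(\mathcal S_1,\mathcal S_2)=(I,I)$ for SDA-1 and $(\mathcal S_1,\mathcal S_2)=(\mathcal J,-I)$ for SDA-2. Setting. Let $(\mathcal M_k,\mathcal L_k)$, $k=1,2,\dots$, be generated by SDA-1 or by SDA-2 without breakdown (all the inverses exist), and let $X^k=[X^k_{ij}]$ be given by $T_{\mathcal S_1,\mathcal S_2}(X^k)=(\mathcal M_k,\mathcal L_k)$. Suppose that $X^1$ is Hermitian and that the pair $(\mathcal M_1,\mathcal L_1)$ is regular ($\det(\mathcal M_1-\lambda\mathcal L_1)\ne0$ for some $\lambda\in\mathbb C$) of index at most one at infinity (the nilpotent block of its Weierstrass form vanishes or is absent). Let $\mathcal H$ be a Hamiltonian matrix attached to $(\mathcal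 M_1,\mathcal L_1)$, i.e. $\mathcal H=\mathbf U(\widehat{\mathcal H}\oplus 0_{2\ell})\mathbf U^{-1}$, where $\hat n+\ell=n$, $\mathbf U=[U_1|U_0,U_\infty]$ with $U_1\in\mathbb C^{2n\times2\hat n}$ and $U_0,U_\infty\in\mathbb C^{2n\times\ell}$ satisfies $\mathbf U^H\mathcal J\mathbf U=J_{\hat n}\oplus J_\ell$, $\mathcal M_1U_0=0$, $\mathcal L_1U_\infty=0$, $\mathcal M_1U_1=\mathcal L_1U_1e^{\widehat{\mathcal H}}$, with $\widehat{\mathcal H}$ Hamiltonian and $e^{\widehat{\mathcal H}}$ symplectic. Suppose that $\mathcal H$ has no purely imaginary eigenvalue ($0$ included), in the sense that $\mathcal S=\begin{bmatrix}U^r_1&V^r_1\\U^r_2&V^r_2\end{bmatrix}$ is a symplectic matrix, with $n\times n$ blocks, for which $$\mathcal S^{-1}\mathcal H\mathcal S=\begin{bmatrix}R_r&0\\0&-R_r^H\end{bmatrix},$$ where $R_r\in\mathbb C^{n\times n}$ is a Jordan matrix (a direct sum of upper Jordan blocks, those with the same eigenvalue adjacent) whose eigenvalues have positive real part. Let $\mathfrak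 r=\min\{\Re(\mathrm{diag}(R_r))\}$ and put $$\begin{bmatrix}\mathscr U_{1,-}\\\mathscr U_{2,-}\end{bmatrix}=\mathcal S_2\begin{bmatrix}V^r_1\\V^r_2\end{bmatrix},\quad \begin{bmatrix}\mathscr U_{1,+}\\\mathscr U_{2,+}\end{bmatrix}=\mathcal J^{-1}\mathcal S_1\begin{bmatrix}U^r_1\\U^r_2\end{bmatrix},$$ $$\begin{bmatrix}W_1^-\\W_2^-\end{bmatrix}=\mathcal S^{-1}\mathcal S_2^{-1}\begin{bmatrix}I\\-X^1_{22}\end{bmatrix},\quad \begin{bmatrix}W_1^+\\W_2^+\end{bmatrix}=\mathcal S^{-1}\mathcal S_1^{-1}\mathcal J\begin{bmatrix}I\\X^1_{11}\end{bmatrix}.$$ Theorem. If $\mathscr U_{1,-}$ and $\mathscr U_{1,+}$ are invertible and $W_1^+$ and $W_2^-$ are invertible (the SDA assumption), then $\mathfrak r>0$, the matrices $\mathscr U_{2,-}\mathscr U_{1,-}^{-1}$ and $\mathscr U_{2,+}\mathscr U_{1,+}^{-1}$ are Hermitian, and as $k\to\infty$ $$X^k_{22}=-\mathscr U_{2,-}\mathscr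 U_{1,-}^{-1}+O(e^{-\mathfrak r2^k}2^{2nk}),\qquad X^k_{12}=O(e^{-\mathfrak r2^{k-1}}2^{nk}),$$ $$X^k_{11}=\mathscr U_{2,+}\mathscr U_{1,+}^{-1}+O(e^{-\mathfrak r2^k}2^{2nk}),\qquad X^k_{21}=O(e^{-\mathfrak r2^{k-1}}2^{nk}).$$ -/

import Mathlib

open Matrix Filter Asymptotics

namespace SDAConv

/-- Complex `2n × 2n` matrices in `2 × 2` block form, with blocks of size `n × n`. -/
abbrev BMat (n : ℕ) : Type := Matrix (Fin n ⊕ Fin n) (Fin n ⊕ Fin n) ℂ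

/-- The matrix `[0, I; -I, 0]`. (Mathlib's `Matrix.J` has the opposite sign.) -/
def bJ (n : ℕ) : BMat n := Matrix.fromBlocks 0 1 (-1) 0

/-- `H` is Hamiltonian: `H J = (H J)ᴴ`. -/
def IsHamiltonian {n : ℕ} (H : BMat n) : Prop :=
  H * bJ n = (H * bJ n)ᴴ

/-- `S` is symplectic: `S J Sᴴ = J` (with the conjugate transpose). -/
def IsSymplectic {n : ℕ} (S : BMat n) : Prop :=
  S * bJ n * Sᴴ = bJ n

/-- The matrix pair `(A, B)` is regular: `det (A - z B) ≠ 0` for some complex `z`. -/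
def IsRegularPair {ι : Type} [Fintype ι] [DecidableEq ι] (A B : Matrix ι ι ℂ) : Prop :=
  ∃ z : ℂ, (A - z • B).det ≠ 0

/-- The index at infinity of the pair `(A, B)` is at most `ν`: the pair is equivalent to a pair
`(diag(K, I), diag(I, N))` with `N ^ ν = 0`. For `ν = 0` this says that `B` is invertible. -/
def IndexInftyLE {ι : Type} [Fintype ι] [DecidableEq ι] (A B : Matrix ι ι ℂ) (ν : ℕ) : Prop :=
  ∃ (p q : ℕ) (e : ι ≃ Fin p ⊕ Fin q) (P Q : Matrix ι ι ℂ)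
    (K : Matrix (Fin p) (Fin p) ℂ) (N : Matrix (Fin q) (Fin q) ℂ),
    IsUnit P ∧ IsUnit Q ∧ N ^ ν = 0 ∧
    P * A * Q = (Matrix.fromBlocks K 0 0 1).submatrix e e ∧
    P * B * Q = (Matrix.fromBlocks 1 0 0 N).submatrix e e

/-- `T_{S₁,S₂}(X) = ([X₁₂, 0; X₂₂, I] S₂, [I, X₁₁; 0, X₂₁] S₁)`. -/
def pairOf {n : ℕ} (S₁ S₂ X : BMat n) : BMat n × BMat n :=
  (Matrix.fromBlocks X.toBlocks₁₂ 0 X.toBlocks₂₂ 1 * S₂,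
   Matrix.fromBlocks 1 X.toBlocks₁₁ 0 X.toBlocks₂₁ * S₁)

/-- `(M k, L k)`, `k = 1, 2, …`, is a sequence of pairs generated by the algorithm SDA-1,
which does not break down. The values at `k = 0` play no role. -/
def IsSDA1 {n : ℕ} (M L : ℕ → BMat n) : Prop :=
  ∃ A G H : ℕ → Matrix (Fin n) (Fin n) ℂ, ∀ k : ℕ, 1 ≤ k →
    M k = Matrix.fromBlocks (A k) 0 (-(H k)) 1 ∧
    L k = Matrix.fromBlocks 1 (G k) 0 (A k)ᴴ ∧
    IsUnit (1 + G k * H k) ∧ IsUnit (1 + H k * G k) ∧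
    A (k + 1) = A k * (1 + G k * H k)⁻¹ * A k ∧
    G (k + 1) = G k + A k * G k * (1 + H k * G k)⁻¹ * (A k)ᴴ ∧
    H (k + 1) = H k + (A k)ᴴ * (1 + H k * G k)⁻¹ * H k * A k

/-- `(M k, L k)`, `k = 1, 2, …`, is a sequence of pairs generated by the algorithm SDA-2,
which does not break down. The values at `k = 0` play no role. -/
def IsSDA2 {n : ℕ} (M L : ℕ → BMat n) : Prop :=
  ∃ A Q P : ℕ → Matrix (Fin n) (Fin n) ℂ, ∀ k : ℕ, 1 ≤ k →
    M k = Matrix.fromBlocks (A k) 0 (Q k) (-1) ∧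
    L k = Matrix.fromBlocks (-(P k)) 1 (A k)ᴴ 0 ∧
    IsUnit (Q k - P k) ∧
    A (k + 1) = A k * (Q k - P k)⁻¹ * A k ∧
    Q (k + 1) = Q k - (A k)ᴴ * (Q k - P k)⁻¹ * A k ∧
    P (k + 1) = P k + A k * (Q k - P k)⁻¹ * (A k)ᴴ

/-- `H` is a Hamiltonian matrix attached to the pair `(M, L)`. Writing `n = m + l` and
`U = [U₁ | U₀, U∞]`, one has `Uᴴ J U = J_m ⊕ J_l`, `M U₀ = 0`, `L U∞ = 0`, `M U₁ = L U₁ Ŝ` with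
`Ŝ` symplectic, `e^Ĥ = Ŝ` with `Ĥ` Hamiltonian, and
`H = U (Ĥ ⊕ 0) U⁻¹`, where `U⁻¹ = (J_m ⊕ J_l)ᴴ Uᴴ J`. -/
def IsAttachedHamiltonian {n : ℕ} (M L H : BMat n) : Prop :=
  ∃ (m l : ℕ) (U₁ : Matrix (Fin n ⊕ Fin n) (Fin m ⊕ Fin m) ℂ)
    (U₀ Uinf : Matrix (Fin n ⊕ Fin n) (Fin l) ℂ) (Shat Hhat : BMat m),
    m + l = n ∧
    (Matrix.fromCols U₁ (Matrix.fromCols U₀ Uinf))ᴴ * bJ n *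
        Matrix.fromCols U₁ (Matrix.fromCols U₀ Uinf) =
      Matrix.fromBlocks (bJ m) 0 0 (bJ l) ∧
    M * U₀ = 0 ∧ L * Uinf = 0 ∧ M * U₁ = L * U₁ * Shat ∧
    IsSymplectic Shat ∧ IsHamiltonian Hhat ∧ NormedSpace.exp Hhat = Shat ∧
    H = Matrix.fromCols U₁ (Matrix.fromCols U₀ Uinf) *
          Matrix.fromBlocks Hhat 0 0 (0 : BMat l) *
          (Matrix.fromBlocks (bJ m) 0 0 (bJ l))ᴴ *
          (Matrix.fromCols U₁ (Matrix.fromCols U₀ Uinf))ᴴ * bJ n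

/-- `R` is a block diagonal matrix of (upper) Jordan blocks, the blocks belonging to the same
eigenvalue being adjacent, and all eigenvalues have positive real part. In terms of entries: `R` is
upper bidiagonal, the superdiagonal entries are `0` or `1`, a superdiagonal entry `1` joins equal
diagonal entries, and equal diagonal entries are contiguous. -/
def IsRightHalfPlaneJordan {n : ℕ} (R : Matrix (Fin n) (Fin n) ℂ) : Prop :=
  (∀ i : Fin n, 0 < (R i i).re) ∧
  (∀ i j : Fin n, j.val ≠ i.val → j.val ≠ i.val + 1 → R i j = 0) ∧
  (∀ i j : Fin n, j.val = i.val + 1 → R i j = 0 ∨ (R i j = 1 ∧ R i i = R j j)) ∧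
  (∀ i j k : Fin n, i ≤ j → j ≤ k → R i i = R k k → R j j = R i i)

/-- The matrix `[𝒰_{1,-}; 𝒰_{2,-}] = S₂ [V₁; V₂]`, where `S = [U₁, V₁; U₂, V₂]`. -/
noncomputable def Uminus {n : ℕ} (S₂ S : BMat n) : Matrix (Fin n ⊕ Fin n) (Fin n) ℂ :=
  S₂ * S.toCols₂

/-- The matrix `[𝒰_{1,+}; 𝒰_{2,+}] = J⁻¹ S₁ [U₁; U₂]`, where `S = [U₁, V₁; U₂, V₂]`. -/
noncomputable def Uplus {n : ℕ} (S₁ S : BMat n) : Matrix (Fin n ⊕ Fin n) (Fin n) ℂ :=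
  (bJ n)⁻¹ * S₁ * S.toCols₁

/-- The matrix `[W₁⁻; W₂⁻] = S⁻¹ S₂⁻¹ [I; -X₂₂]`. -/
noncomputable def Wminus {n : ℕ} (S₂ S X : BMat n) : Matrix (Fin n ⊕ Fin n) (Fin n) ℂ :=
  S⁻¹ * S₂⁻¹ * Matrix.fromRows 1 (-X.toBlocks₂₂)

/-- The matrix `[W₁⁺; W₂⁺] = S⁻¹ S₁⁻¹ J [I; X₁₁]`. -/
noncomputable def Wplus {n : ℕ} (S₁ S X : BMat n) : Matrix (Fin n ⊕ Fin n) (Fin n) ℂ :=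
  S⁻¹ * S₁⁻¹ * bJ n * Matrix.fromRows 1 X.toBlocks₁₁

/-- `F k = O(g k)` as `k → ∞` for a sequence of (finite) matrices, entry by entry; this is the same
as `‖F k‖ = O(g k)` for any norm on matrices. -/
def MatIsBigO {n : ℕ} (F : ℕ → Matrix (Fin n) (Fin n) ℂ) (g : ℕ → ℝ) : Prop :=
  ∀ i j : Fin n, (fun k : ℕ => F k i j) =O[atTop] g

end SDAConv

open SDAConv

/-!
Since `R` is invertible, so is `H`, and therefore the Hamiltonian matrix attached to `(M₁, L₁)` has
no zero summand: `M₁ = L₁ e^H` (`IsAttachedHamiltonian.eq_mul_exp`). Each step of either algorithm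
multiplies the pair from the left in such a way that the matrix relating its members is squared,
whence `M_k = L_k e^{2^{k-1} H}` (`pair_eq_mul_pow`). Hermitian initial data are needed here: only
then does the block `A_{k+1}ᴴ` prescribed for `L_{k+1}` agree with the one that this multiplication
produces.

Let `E_k = e^{-2^{k-1} R}`, which is `O(g_k)` for `g_k = e^{-r 2^{k-1}} 2^{nk} → 0`. Applied to
the two halves `U`, `V` of the columns of `S`, the relation between `M_k` and `L_k` becomes
`M_k V = L_k V E_kᴴ` and `M_k U E_k = L_k U`. In blocks, with the invertibility of `𝒰_{1,∓}`, these
are four equations (`graph_relations`, `dual_graph_relations`), which split into one system for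
`X₁₁, X₁₂` and one for `X₂₂, X₂₁`. Each system has the shape
`y_k = (a + x_k b) O(g_k)`, `x_k - x₀ = y_k O(g_k)`, with `y_k` the off-diagonal block, and yields
`y_k = O(g_k)`, `x_k - x₀ = O(g_k²)` (`isBigO_of_coupled`). As these equations hold for every
sequence generated without breakdown, boundedness of the iterates is a consequence and not an
assumption. The limits are Hermitian because the column halves of a symplectic matrix span
Lagrangian subspaces.
-/

namespace SDAConv

/-! ### Exponentials and the form `J` -/

/-- An intertwining relation `A B = B C`, with `B` possibly rectangular, passes to exponentials. -/
theorem exp_mul_eq_mul_exp {m p : Type*} [Fintype m] [DecidableEq m] [Fintype p] [DecidableEq p]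
    {A : Matrix m m ℂ} {C : Matrix p p ℂ} {B : Matrix m p ℂ} (h : A * B = B * C) :
    NormedSpace.exp A * B = B * NormedSpace.exp C := by
  open scoped Matrix.Norms.Operator in
  have hpow : ∀ j : ℕ, A ^ j * B = B * C ^ j := by
    intro j
    induction j with
    | zero => simp
    | succ j ih => rw [pow_succ, Matrix.mul_assoc, h, ← Matrix.mul_assoc, ih, Matrix.mul_assoc,
        ← pow_succ]
  have hA := (NormedSpace.exp_series_hasSum_exp' (𝕂 := ℂ) A).map (Matrix.addMonoidHomMulRight B)
    (continuous_id.matrix_mul continuous_const)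
  have hC := (NormedSpace.exp_series_hasSum_exp' (𝕂 := ℂ) C).map (Matrix.addMonoidHomMulLeft B)
    (continuous_const.matrix_mul continuous_id)
  refine hA.unique ?_
  convert hC using 1
  · funext j
    simp [addMonoidHomMulRight, addMonoidHomMulLeft, hpow]
  · rfl

theorem bJ_mul_self (n : ℕ) : bJ n * bJ n = -1 := by
  simp [bJ, fromBlocks_multiply, ← fromBlocks_one, fromBlocks_neg]

theorem bJ_conjTranspose (n : ℕ) : (bJ n)ᴴ = -bJ n := by
  simp [bJ, fromBlocks_conjTranspose, fromBlocks_neg]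

theorem bJ_inv (n : ℕ) : (bJ n)⁻¹ = -bJ n :=
  inv_eq_right_inv (by rw [mul_neg, bJ_mul_self, neg_neg])

/-- The inverse of a symplectic matrix `S` is `-J Sᴴ J`. -/
theorem IsSymplectic.mul_eq_one {n : ℕ} {S : BMat n} (hS : IsSymplectic S) :
    S * -(bJ n * Sᴴ * bJ n) = 1 := by
  have h : S * bJ n * Sᴴ = bJ n := hS
  rw [mul_neg, ← mul_assoc, ← mul_assoc, h, bJ_mul_self, neg_neg]

/-- The conjugate transpose of a symplectic matrix is symplectic. -/
theorem IsSymplectic.conjTranspose_mul {n : ℕ} {S : BMat n} (hS : IsSymplectic S) :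
    Sᴴ * bJ n * S = bJ n := by
  have h := mul_eq_one_comm.mp hS.mul_eq_one
  have h' : bJ n * (-(bJ n * Sᴴ * bJ n) * S) = Sᴴ * bJ n * S := by
    simp only [neg_mul, mul_neg, ← mul_assoc, bJ_mul_self]
    simp
  rw [← h', h, mul_one]

/-- A Lagrangian subspace that is a graph, i.e. spanned by the columns of `[Y₁; Y₂]` with `Y₁`
invertible, is the graph of a Hermitian matrix. -/
theorem isHermitian_mul_inv_of_isotropic {n : ℕ} {Y : Matrix (Fin n ⊕ Fin n) (Fin n) ℂ}
    (hY : Yᴴ * bJ n * Y = 0) (hu : IsUnit Y.toRows₁) :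
    (Y.toRows₂ * Y.toRows₁⁻¹).IsHermitian := by
  obtain ⟨P, Q, rfl⟩ : ∃ P Q, Y = fromRows P Q := ⟨_, _, (fromRows_toRows Y).symm⟩
  simp only [toRows₁_fromRows, toRows₂_fromRows] at *
  have hd : IsUnit P.det := (isUnit_iff_isUnit_det _).mp hu
  have hdH : IsUnit Pᴴ.det := by rw [det_conjTranspose]; exact hd.star
  have key : Pᴴ * Q = Qᴴ * P := by
    rw [bJ, conjTranspose_fromRows_eq_fromCols_conjTranspose] at hY
    simp [fromCols_mul_fromBlocks, fromCols_mul_fromRows] at hY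
    rw [neg_add_eq_zero] at hY
    exact hY.symm
  rw [IsHermitian, conjTranspose_mul, conjTranspose_nonsing_inv]
  calc (Pᴴ)⁻¹ * Qᴴ = (Pᴴ)⁻¹ * (Qᴴ * P) * P⁻¹ := by
        rw [Matrix.mul_assoc, Matrix.mul_assoc, mul_nonsing_inv _ hd, Matrix.mul_one]
    _ = Q * P⁻¹ := by
        rw [← key, ← Matrix.mul_assoc, nonsing_inv_mul _ hdH, Matrix.one_mul]

theorem IsSymplectic.isotropic_toCols₁ {n : ℕ} {S : BMat n} (hS : IsSymplectic S) :
    S.toCols₁ᴴ * bJ n * S.toCols₁ = 0 := by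
  have h := hS.conjTranspose_mul
  have h2 := congrArg toBlocks₁₁ h
  rw [bJ, toBlocks_fromBlocks₁₁] at h2
  ext i j
  simpa [Matrix.mul_apply, toBlocks₁₁, bJ] using congrFun₂ h2 i j

theorem IsSymplectic.isotropic_toCols₂ {n : ℕ} {S : BMat n} (hS : IsSymplectic S) :
    S.toCols₂ᴴ * bJ n * S.toCols₂ = 0 := by
  have h := hS.conjTranspose_mul
  have h2 := congrArg toBlocks₂₂ h
  rw [bJ, toBlocks_fromBlocks₂₂] at h2
  ext i j
  simpa [Matrix.mul_apply, toBlocks₂₂, bJ] using congrFun₂ h2 i j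

theorem isotropic_mul {n : ℕ} {T : BMat n} {Y : Matrix (Fin n ⊕ Fin n) (Fin n) ℂ}
    (hT : Tᴴ * bJ n * T = bJ n) (hY : Yᴴ * bJ n * Y = 0) : (T * Y)ᴴ * bJ n * (T * Y) = 0 := by
  have : (T * Y)ᴴ * bJ n * (T * Y) = Yᴴ * (Tᴴ * bJ n * T) * Y := by
    simp only [conjTranspose_mul, Matrix.mul_assoc]
  rw [this, hT, hY]

/-- An invertible attached Hamiltonian matrix has no summand `0`, for otherwise its rank would be too
small. Hence `U₁` is square and invertible, and `M U₁ = L U₁ e^Ĥ` reads `M = L e^H`. -/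
theorem IsAttachedHamiltonian.eq_mul_exp {n : ℕ} {M L H : BMat n}
    (hH : IsAttachedHamiltonian M L H) (hu : IsUnit H) : M = L * NormedSpace.exp H := by
  obtain ⟨m, l, U₁, U₀, Ui, Sh, Hh, hml, hU, -, -, hMU, -, -, hexp, rfl⟩ := hH
  obtain rfl : l = 0 := by
    have hr := rank_of_isUnit _ hu
    set K : Matrix ((Fin m ⊕ Fin m) ⊕ (Fin l ⊕ Fin l)) (Fin n ⊕ Fin n) ℂ :=
      (fromBlocks (bJ m) 0 0 (bJ l))ᴴ * (fromCols U₁ (fromCols U₀ Ui))ᴴ * bJ n with hK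
    have hfac : fromCols U₁ (fromCols U₀ Ui) * fromBlocks Hh 0 0 (0 : BMat l) *
        (fromBlocks (bJ m) 0 0 (bJ l))ᴴ * (fromCols U₁ (fromCols U₀ Ui))ᴴ * bJ n =
        U₁ * (Hh * K.toRows₁) := by
      have : fromCols U₁ (fromCols U₀ Ui) * fromBlocks Hh 0 0 (0 : BMat l) =
          fromCols (U₁ * Hh) 0 := by
        simp [fromCols_mul_fromBlocks]
      simp only [Matrix.mul_assoc] at hK
      rw [this, Matrix.mul_assoc, Matrix.mul_assoc, ← hK]
      conv_lhs => rw [← fromRows_toRows K, fromCols_mul_fromRows]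
      rw [Matrix.zero_mul, add_zero, Matrix.mul_assoc]
    rw [hfac] at hr
    have := (rank_mul_le_left U₁ (Hh * K.toRows₁)).trans (rank_le_card_width U₁)
    rw [hr] at this
    simp at this
    omega
  obtain rfl : m = n := by omega
  have hUJ : U₁ᴴ * bJ m * U₁ = bJ m := by
    rw [conjTranspose_fromCols_eq_fromRows_conjTranspose, fromRows_mul, fromRows_mul_fromCols,
      fromBlocks_inj] at hU
    exact hU.1
  have hinv : U₁ * ((bJ m)ᴴ * U₁ᴴ * bJ m) = 1 := by
    rw [mul_eq_one_comm, Matrix.mul_assoc, Matrix.mul_assoc, ← Matrix.mul_assoc U₁ᴴ, hUJ,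
      bJ_conjTranspose, neg_mul, bJ_mul_self, neg_neg]
  have hfac : fromCols U₁ (fromCols U₀ Ui) * fromBlocks Hh 0 0 (0 : BMat 0) *
        (fromBlocks (bJ m) 0 0 (bJ 0))ᴴ * (fromCols U₁ (fromCols U₀ Ui))ᴴ * bJ m =
        U₁ * Hh * ((bJ m)ᴴ * U₁ᴴ * bJ m) := by
    have : fromCols U₁ (fromCols U₀ Ui) * fromBlocks Hh 0 0 (0 : BMat 0) =
        fromCols (U₁ * Hh) 0 := by
      simp [fromCols_mul_fromBlocks]
    rw [this, fromBlocks_conjTranspose]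
    simp [fromCols_mul_fromBlocks, conjTranspose_fromCols_eq_fromRows_conjTranspose,
      fromCols_mul_fromRows, Matrix.mul_assoc]
  rw [hfac]
  have hint : NormedSpace.exp (U₁ * Hh * ((bJ m)ᴴ * U₁ᴴ * bJ m)) * U₁ = U₁ * Sh := by
    rw [← hexp]
    refine exp_mul_eq_mul_exp ?_
    rw [Matrix.mul_assoc, mul_eq_one_comm.mp hinv, Matrix.mul_one]
  have hM : M = M * U₁ * ((bJ m)ᴴ * U₁ᴴ * bJ m) := by
    rw [Matrix.mul_assoc, hinv, Matrix.mul_one]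
  rw [hM, hMU, Matrix.mul_assoc L, ← hint, Matrix.mul_assoc L, Matrix.mul_assoc _ U₁, hinv,
    Matrix.mul_one]

/-! ### The doubling steps -/

theorem mul_pow_doubling {n : ℕ} {M L M' L' Ms Ls E : BMat n} (hML : M = L * E)
    (hc : Ms * L = Ls * M) (hM : M' = Ms * M) (hL : L' = Ls * L) : M' = L' * (E * E) := by
  calc M' = Ms * L * E := by rw [hM, hML, mul_assoc]
    _ = L' * (E * E) := by rw [hc, hL, hML]; simp only [mul_assoc]

/-- A doubling step multiplies the pair `(M, L)` from the left by `(Ms, Ls)` with `Ms L = Ls M`; it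
turns `M = L E` into `M' = L' E²`. -/
theorem eq_mul_pow_of_doubling {n : ℕ} {M L : ℕ → BMat n} {E : BMat n} (h1 : M 1 = L 1 * E)
    (hd : ∀ k, 1 ≤ k → ∃ Ms Ls : BMat n, Ms * L k = Ls * M k ∧ M (k + 1) = Ms * M k ∧
      L (k + 1) = Ls * L k) (k : ℕ) (hk : 1 ≤ k) : M k = L k * E ^ 2 ^ (k - 1) := by
  induction k, hk using Nat.le_induction with
  | base => simpa using h1
  | succ k hk ih =>
    obtain ⟨Ms, Ls, hc, hM, hL⟩ := hd k hk
    rw [mul_pow_doubling ih hc hM hL, ← pow_add, ← two_mul, ← pow_succ']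
    congr 3
    omega

theorem inv_one_add_mul_comm {n : ℕ} {G H : Matrix (Fin n) (Fin n) ℂ}
    (hW : IsUnit (1 + G * H)) (hV : IsUnit (1 + H * G)) :
    (1 + G * H)⁻¹ * G = G * (1 + H * G)⁻¹ := by
  have hW' := (isUnit_iff_isUnit_det _).mp hW
  have hV' := (isUnit_iff_isUnit_det _).mp hV
  have : G * (1 + H * G) = (1 + G * H) * G := by noncomm_ring
  calc _ = (1 + G * H)⁻¹ * (G * (1 + H * G)) * (1 + H * G)⁻¹ := by
        rw [Matrix.mul_assoc, Matrix.mul_assoc, mul_nonsing_inv _ hV', Matrix.mul_one]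
    _ = _ := by rw [this, ← Matrix.mul_assoc, nonsing_inv_mul _ hW', Matrix.one_mul]

theorem inv_one_add_mul_add {n : ℕ} {G H : Matrix (Fin n) (Fin n) ℂ} (hV : IsUnit (1 + H * G)) :
    (1 + H * G)⁻¹ + (1 + H * G)⁻¹ * H * G = 1 := by
  have := nonsing_inv_mul _ ((isUnit_iff_isUnit_det _).mp hV)
  rwa [Matrix.mul_add, Matrix.mul_one, ← Matrix.mul_assoc] at this

theorem conjTranspose_inv_one_add_mul {n : ℕ} {G H : Matrix (Fin n) (Fin n) ℂ}
    (hG : Gᴴ = G) (hH : Hᴴ = H) : ((1 + G * H)⁻¹)ᴴ = (1 + H * G)⁻¹ := by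
  rw [conjTranspose_nonsing_inv]
  simp [hG, hH]

/-- One step of SDA-1 is a doubling step, provided that `G` and `H` are Hermitian. -/
theorem sda1_doubling {n : ℕ} {A G H : Matrix (Fin n) (Fin n) ℂ} (hG : Gᴴ = G) (hH : Hᴴ = H)
    (hW : IsUnit (1 + G * H)) (hV : IsUnit (1 + H * G)) :
    ∃ Ms Ls : BMat n,
      Ms * (fromBlocks 1 G 0 Aᴴ : BMat n) = Ls * (fromBlocks A 0 (-H) 1 : BMat n) ∧
      fromBlocks (A * (1 + G * H)⁻¹ * A) 0 (-(H + Aᴴ * (1 + H * G)⁻¹ * H * A)) 1 =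
        Ms * (fromBlocks A 0 (-H) 1 : BMat n) ∧
      fromBlocks 1 (G + A * G * (1 + H * G)⁻¹ * Aᴴ) 0 (A * (1 + G * H)⁻¹ * A)ᴴ =
        Ls * (fromBlocks 1 G 0 Aᴴ : BMat n) := by
  have hGW := inv_one_add_mul_comm hW hV
  have hWadd := inv_one_add_mul_add hW
  have hVadd := inv_one_add_mul_add hV
  have hWV := conjTranspose_inv_one_add_mul hG hH
  set W := (1 + G * H)⁻¹
  set V := (1 + H * G)⁻¹
  refine ⟨fromBlocks (A * W) 0 (-(Aᴴ * V * H)) 1, fromBlocks 1 (A * G * V) 0 (Aᴴ * V), ?_, ?_, ?_⟩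
  · have e1 : A * W = A + -(A * G * V * H) := by
      calc A * W = A * (W + W * G * H) - A * (W * G) * H := by noncomm_ring
        _ = _ := by rw [hWadd, hGW]; noncomm_ring
    have e2 : A * W * G = A * G * V := by rw [Matrix.mul_assoc, hGW, Matrix.mul_assoc]
    have e3 : -(Aᴴ * V * H * G) + Aᴴ = Aᴴ * V := by
      calc _ = -(Aᴴ * V * H * G) + Aᴴ * (V + V * H * G) := by rw [hVadd, Matrix.mul_one]
        _ = _ := by noncomm_ring
    simp [fromBlocks_multiply, ← e1, e2, e3]
  · simp [fromBlocks_multiply, add_comm]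
  · simp [fromBlocks_multiply, hWV, Matrix.mul_assoc]

/-- One step of SDA-2 is a doubling step, provided that `Q` and `P` are Hermitian. -/
theorem sda2_doubling {n : ℕ} {A Q P : Matrix (Fin n) (Fin n) ℂ} (hQ : Qᴴ = Q) (hP : Pᴴ = P)
    (hu : IsUnit (Q - P)) :
    ∃ Ms Ls : BMat n,
      Ms * (fromBlocks (-P) 1 Aᴴ 0 : BMat n) = Ls * (fromBlocks A 0 Q (-1) : BMat n) ∧
      fromBlocks (A * (Q - P)⁻¹ * A) 0 (Q - Aᴴ * (Q - P)⁻¹ * A) (-1) =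
        Ms * (fromBlocks A 0 Q (-1) : BMat n) ∧
      fromBlocks (-(P + A * (Q - P)⁻¹ * Aᴴ)) 1 (A * (Q - P)⁻¹ * A)ᴴ 0 =
        Ls * (fromBlocks (-P) 1 Aᴴ 0 : BMat n) := by
  have hZ := nonsing_inv_mul _ ((isUnit_iff_isUnit_det _).mp hu)
  have hZH : ((Q - P)⁻¹)ᴴ = (Q - P)⁻¹ := by
    rw [conjTranspose_nonsing_inv, conjTranspose_sub, hQ, hP]
  set Z := (Q - P)⁻¹
  refine ⟨fromBlocks (A * Z) 0 (-(Aᴴ * Z)) 1, fromBlocks 1 (-(A * Z)) 0 (Aᴴ * Z), ?_, ?_, ?_⟩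
  · have e1 : -(A * Z * P) = A + -(A * Z * Q) := by
      calc _ = A * (Z * (Q - P)) - A * Z * Q := by noncomm_ring
        _ = _ := by rw [hZ]; noncomm_ring
    have e2 : Aᴴ * Z * P + Aᴴ = Aᴴ * Z * Q := by
      calc _ = Aᴴ * Z * P + Aᴴ * (Z * (Q - P)) := by rw [hZ, Matrix.mul_one]
        _ = _ := by noncomm_ring
    simp [fromBlocks_multiply, ← e1, e2]
  · simp [fromBlocks_multiply]
    abel
  · simp [fromBlocks_multiply, hZH, Matrix.mul_assoc]
    abel

theorem IsSDA1.eq_mul_pow {n : ℕ} {M L : ℕ → BMat n} (h : IsSDA1 M L)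
    (hG : (L 1).toBlocks₁₂.IsHermitian) (hH : (M 1).toBlocks₂₁.IsHermitian)
    {E : BMat n} (h1 : M 1 = L 1 * E) (k : ℕ) (hk : 1 ≤ k) : M k = L k * E ^ 2 ^ (k - 1) := by
  obtain ⟨A, G, H, h⟩ := h
  have herm : ∀ k, 1 ≤ k → (G k)ᴴ = G k ∧ (H k)ᴴ = H k := by
    intro k hk
    induction k, hk using Nat.le_induction with
    | base =>
      rw [(h 1 le_rfl).2.1, toBlocks_fromBlocks₁₂] at hG
      rw [(h 1 le_rfl).1, toBlocks_fromBlocks₂₁] at hH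
      exact ⟨hG, by simpa [IsHermitian] using hH⟩
    | succ k hk ih =>
      obtain ⟨iG, iH⟩ := ih
      obtain ⟨-, -, hW, hV, -, hG', hH'⟩ := h k hk
      have e1 := inv_one_add_mul_comm hW hV
      have e2 := inv_one_add_mul_comm hV hW
      have c1 := conjTranspose_inv_one_add_mul iH iG
      rw [hG', hH']
      constructor
      · simp only [conjTranspose_add, conjTranspose_mul, conjTranspose_conjTranspose, iG, c1]
        simp only [Matrix.mul_assoc, ← e1]
      · simp only [conjTranspose_add, conjTranspose_mul, conjTranspose_conjTranspose, iH, c1]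
        rw [Matrix.mul_assoc (A k)ᴴ, e2]
        simp only [Matrix.mul_assoc]
  refine eq_mul_pow_of_doubling h1 (fun k hk => ?_) k hk
  obtain ⟨hM, hL, hW, hV, hA, hG', hH'⟩ := h k hk
  rw [hM, hL, (h (k + 1) (by omega)).1, (h (k + 1) (by omega)).2.1, hA, hG', hH']
  exact sda1_doubling (herm k hk).1 (herm k hk).2 hW hV

theorem IsSDA2.eq_mul_pow {n : ℕ} {M L : ℕ → BMat n} (h : IsSDA2 M L)
    (hP : (L 1).toBlocks₁₁.IsHermitian) (hQ : (M 1).toBlocks₂₁.IsHermitian)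
    {E : BMat n} (h1 : M 1 = L 1 * E) (k : ℕ) (hk : 1 ≤ k) : M k = L k * E ^ 2 ^ (k - 1) := by
  obtain ⟨A, Q, P, h⟩ := h
  have herm : ∀ k, 1 ≤ k → (Q k)ᴴ = Q k ∧ (P k)ᴴ = P k := by
    intro k hk
    induction k, hk using Nat.le_induction with
    | base =>
      rw [(h 1 le_rfl).2.1, toBlocks_fromBlocks₁₁] at hP
      rw [(h 1 le_rfl).1, toBlocks_fromBlocks₂₁] at hQ
      exact ⟨hQ, by simpa [IsHermitian] using hP⟩
    | succ k hk ih =>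
      obtain ⟨iQ, iP⟩ := ih
      obtain ⟨-, -, -, -, hQ', hP'⟩ := h k hk
      rw [hQ', hP']
      constructor <;>
      simp [conjTranspose_nonsing_inv, iQ, iP, Matrix.mul_assoc]
  refine eq_mul_pow_of_doubling h1 (fun k hk => ?_) k hk
  obtain ⟨hM, hL, hu, hA, hQ', hP'⟩ := h k hk
  rw [hM, hL, (h (k + 1) (by omega)).1, (h (k + 1) (by omega)).2.1, hA, hQ', hP']
  exact sda2_doubling (herm k hk).1 (herm k hk).2 hu

/-- Both algorithms square the matrix `E` in `M = L E` at every step. -/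
theorem pair_eq_mul_pow {n : ℕ} {S₁ S₂ : BMat n} {X M L : ℕ → BMat n}
    (hSDA : (S₁ = 1 ∧ S₂ = 1 ∧ IsSDA1 M L) ∨ (S₁ = bJ n ∧ S₂ = -1 ∧ IsSDA2 M L))
    (hX : pairOf S₁ S₂ (X 1) = (M 1, L 1)) (hX1 : (X 1).IsHermitian)
    {E : BMat n} (h1 : M 1 = L 1 * E) (k : ℕ) (hk : 1 ≤ k) : M k = L k * E ^ 2 ^ (k - 1) := by
  have h11 : (X 1).toBlocks₁₁.IsHermitian := hX1.submatrix Sum.inl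
  have h22 : (X 1).toBlocks₂₂.IsHermitian := hX1.submatrix Sum.inr
  obtain ⟨hM, hL⟩ := Prod.ext_iff.mp hX
  simp only [pairOf] at hM hL
  rcases hSDA with ⟨rfl, rfl, h⟩ | ⟨rfl, rfl, h⟩
  · refine h.eq_mul_pow ?_ ?_ h1 k hk
    · rwa [← hL, mul_one, toBlocks_fromBlocks₁₂]
    · rwa [← hM, mul_one, toBlocks_fromBlocks₂₁]
  · refine h.eq_mul_pow ?_ ?_ h1 k hk
    · rw [← hL, bJ, fromBlocks_multiply, toBlocks_fromBlocks₁₁]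
      simpa using h11.neg
    · rw [← hM, mul_neg, mul_one, fromBlocks_neg, toBlocks_fromBlocks₂₁]
      exact h22.neg

/-! ### The invariant subspaces -/

theorem IsRightHalfPlaneJordan.isUnit {n : ℕ} {R : Matrix (Fin n) (Fin n) ℂ}
    (hR : IsRightHalfPlaneJordan R) : IsUnit R := by
  obtain ⟨hpos, hz, -, -⟩ := hR
  rw [isUnit_iff_isUnit_det, det_of_isUpperTriangular, isUnit_iff_ne_zero,
    Finset.prod_ne_zero_iff]
  · intro i _ h
    have := hpos i
    rw [h] at this
    exact lt_irrefl _ this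
  · intro i j hij
    have : j.val < i.val := hij
    exact hz i j (by omega) (by omega)

theorem mul_toCols_of_conj_eq {n : ℕ} {S H : BMat n} {A D : Matrix (Fin n) (Fin n) ℂ}
    (hS : IsUnit S) (h : S⁻¹ * H * S = fromBlocks A 0 0 D) :
    H * S.toCols₁ = S.toCols₁ * A ∧ H * S.toCols₂ = S.toCols₂ * D := by
  have h' : H * S = S * fromBlocks A 0 0 D := by
    rw [← h, ← mul_assoc, ← mul_assoc, mul_nonsing_inv _ ((isUnit_iff_isUnit_det _).mp hS),
      one_mul]
  have h'' : H * fromCols S.toCols₁ S.toCols₂ =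
      fromCols S.toCols₁ S.toCols₂ * fromBlocks A 0 0 D := by rw [fromCols_toCols, h']
  rw [mul_fromCols, fromCols_mul_fromBlocks] at h''
  obtain ⟨h1, h2⟩ := fromCols_inj h''
  exact ⟨by rw [h1, Matrix.mul_zero, add_zero], by rw [h2, Matrix.mul_zero, zero_add]⟩

/-- Powers of `e^H` contract the stable invariant subspace. -/
theorem exp_pow_mul_of_stable {n : ℕ} {H : BMat n} {V : Matrix (Fin n ⊕ Fin n) (Fin n) ℂ}
    {R : Matrix (Fin n) (Fin n) ℂ} (h : H * V = V * -Rᴴ) (N : ℕ) :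
    NormedSpace.exp H ^ N * V = V * (NormedSpace.exp (-(N • R)))ᴴ := by
  rw [← Matrix.exp_nsmul, ← Matrix.exp_conjTranspose]
  refine exp_mul_eq_mul_exp ?_
  rw [Matrix.smul_mul, h, conjTranspose_neg, conjTranspose_nsmul, ← smul_neg, Matrix.mul_smul]

/-- Powers of `e^H` expand the unstable invariant subspace; the expansion is undone by the decaying
factor `e^{-N R}`. -/
theorem exp_pow_mul_of_unstable {n : ℕ} {H : BMat n} {U : Matrix (Fin n ⊕ Fin n) (Fin n) ℂ}
    {R : Matrix (Fin n) (Fin n) ℂ} (h : H * U = U * R) (N : ℕ) :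
    NormedSpace.exp H ^ N * U * NormedSpace.exp (-(N • R)) = U := by
  have h' : NormedSpace.exp (N • H) * U = U * NormedSpace.exp (N • R) :=
    exp_mul_eq_mul_exp (by rw [Matrix.smul_mul, h, Matrix.mul_smul])
  rw [← Matrix.exp_nsmul, h', Matrix.mul_assoc,
    ← Matrix.exp_add_of_commute _ _ (Commute.refl (N • R)).neg_right, add_neg_cancel,
    NormedSpace.exp_zero, Matrix.mul_one]

/-- The block form of the equation `M V = L V F` for the stable invariant subspace, where
`P = S₂ V` and `Q = S₁ V`. -/
theorem graph_relations {n : ℕ} {A B C D F : Matrix (Fin n) (Fin n) ℂ}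
    {P Q : Matrix (Fin n ⊕ Fin n) (Fin n) ℂ}
    (h : (fromBlocks A 0 C 1 : BMat n) * P = (fromBlocks 1 B 0 D : BMat n) * Q * F) (hP : IsUnit P.toRows₁) :
    A = (Q.toRows₁ + B * Q.toRows₂) * F * P.toRows₁⁻¹ ∧
    C - -(P.toRows₂ * P.toRows₁⁻¹) = D * Q.toRows₂ * F * P.toRows₁⁻¹ := by
  obtain ⟨P₁, P₂, rfl⟩ : ∃ P₁ P₂, P = fromRows P₁ P₂ := ⟨_, _, (fromRows_toRows P).symm⟩
  obtain ⟨Q₁, Q₂, rfl⟩ : ∃ Q₁ Q₂, Q = fromRows Q₁ Q₂ := ⟨_, _, (fromRows_toRows Q).symm⟩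
  simp only [toRows₁_fromRows, toRows₂_fromRows] at *
  have hd := (isUnit_iff_isUnit_det _).mp hP
  simp only [fromBlocks_mul_fromRows, fromRows_mul, Matrix.zero_mul, Matrix.one_mul, zero_add,
    add_zero] at h
  obtain ⟨h1, h2⟩ := fromRows_inj h
  constructor
  · rw [← h1, Matrix.mul_assoc, mul_nonsing_inv _ hd, Matrix.mul_one]
  · rw [← h2, Matrix.add_mul, Matrix.mul_assoc C, mul_nonsing_inv _ hd, Matrix.mul_one,
      sub_neg_eq_add]

/-- The block form of the equation `M U F = L U` for the unstable invariant subspace, where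
`Z = S₂ U` and `J Y = S₁ U`. -/
theorem dual_graph_relations {n : ℕ} {A B C D F : Matrix (Fin n) (Fin n) ℂ}
    {Y Z : Matrix (Fin n ⊕ Fin n) (Fin n) ℂ}
    (h : (fromBlocks A 0 C 1 : BMat n) * Z * F = (fromBlocks 1 B 0 D : BMat n) * (bJ n * Y))
    (hY : IsUnit Y.toRows₁) :
    D = (Z.toRows₂ + C * Z.toRows₁) * F * -Y.toRows₁⁻¹ ∧
    B - Y.toRows₂ * Y.toRows₁⁻¹ = A * Z.toRows₁ * F * -Y.toRows₁⁻¹ := by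
  obtain ⟨Y₁, Y₂, rfl⟩ : ∃ Y₁ Y₂, Y = fromRows Y₁ Y₂ := ⟨_, _, (fromRows_toRows Y).symm⟩
  obtain ⟨Z₁, Z₂, rfl⟩ : ∃ Z₁ Z₂, Z = fromRows Z₁ Z₂ := ⟨_, _, (fromRows_toRows Z).symm⟩
  simp only [toRows₁_fromRows, toRows₂_fromRows] at *
  have hd := (isUnit_iff_isUnit_det _).mp hY
  simp only [bJ, fromBlocks_mul_fromRows, fromRows_mul, Matrix.zero_mul, Matrix.one_mul, zero_add,
    add_zero, Matrix.neg_mul, Matrix.mul_neg] at h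
  obtain ⟨h1, h2⟩ := fromRows_inj h
  constructor
  · rw [add_comm Z₂, h2, Matrix.mul_neg, Matrix.neg_mul, neg_neg, Matrix.mul_assoc,
      mul_nonsing_inv _ hd, Matrix.mul_one]
  · rw [h1, Matrix.mul_neg, Matrix.add_mul, Matrix.neg_mul, Matrix.mul_assoc B,
      mul_nonsing_inv _ hd, Matrix.mul_one]
    abel

/-! ### Rates of convergence -/

section Norms

open scoped Matrix.Norms.Operator

/-- The decay of `e^{-j R}`: the diagonal part of `R` commutes with the nilpotent superdiagonal part,
whose exponential grows polynomially. -/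
theorem isBigO_pow_mul_exp {n : ℕ} {R : Matrix (Fin n) (Fin n) ℂ}
    (hR : IsRightHalfPlaneJordan R) {r : ℝ} (hr : ∀ i, r ≤ (R i i).re) :
      (fun j : ℕ => NormedSpace.exp (-(j • R))) =O[atTop]
      fun j : ℕ => (j : ℝ) ^ n * Real.exp (-r * j) := by
  obtain ⟨-, hz, hs, -⟩ := hR
  set D : Matrix (Fin n) (Fin n) ℂ := diagonal fun i => R i i with hD
  set N := R - D with hN
  have hN0 : ∀ i j : Fin n, j.val ≠ i.val + 1 → N i j = 0 := by
    intro i j hij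
    by_cases h : i = j
    · subst h; simp [hN, hD]
    · have := hz i j (fun h' => h (Fin.ext h'.symm)) hij
      simp [hN, hD, this, h]
  -- A nonzero superdiagonal entry joins equal diagonal entries.
  have hcomm : Commute D N := by
    ext i j
    rw [hD, diagonal_mul, mul_diagonal]
    by_cases hij : j.val = i.val + 1
    · rcases hs i j hij with h | ⟨-, h⟩
      · have : i ≠ j := by rintro rfl; omega
        simp [hN, hD, h, this]
      · rw [h, mul_comm]
    · simp [hN0 i j hij]
  have hpow : ∀ (p : ℕ) (i j : Fin n), j.val < i.val + p → (N ^ p) i j = 0 := by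
    intro p
    induction p with
    | zero =>
      intro i j h
      rw [pow_zero, one_apply_ne (by rintro rfl; omega)]
    | succ p ih =>
      intro i j h
      rw [pow_succ, Matrix.mul_apply]
      refine Finset.sum_eq_zero fun k _ => ?_
      by_cases hk : j.val = k.val + 1
      · rw [ih i k (by omega), zero_mul]
      · rw [hN0 k j hk, mul_zero]
  have hNn : ∀ p, n ≤ p → N ^ p = 0 := by
    intro p hp
    ext i j
    exact hpow p i j (by omega)
  -- The exponential of the nilpotent part is a polynomial of degree less than `n`.
  have hexpN : ∀ j : ℕ, NormedSpace.exp (-(j • N)) =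
      ∑ p ∈ Finset.range n, ((p.factorial : ℂ)⁻¹ * (-(j : ℂ)) ^ p) • N ^ p := by
    intro j
    have e : -(j • N) = (-(j : ℂ)) • N := by simp [Nat.cast_smul_eq_nsmul]
    rw [NormedSpace.exp_eq_tsum ℂ, e]
    simp only [smul_pow, smul_smul]
    exact tsum_eq_sum fun p hp => by
      rw [hNn p (by simpa using hp), smul_zero]
  have hsplit : ∀ j : ℕ, NormedSpace.exp (-(j • R)) =
      NormedSpace.exp (-(j • D)) * NormedSpace.exp (-(j • N)) := by
    intro j
    rw [← Matrix.exp_add_of_commute]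
    · congr 1
      rw [hN, smul_sub]
      abel
    · exact ((hcomm.smul_left j).smul_right j).neg_left.neg_right
  have hbD : (fun j : ℕ => NormedSpace.exp (-(j • D))) =O[atTop]
      fun j : ℕ => Real.exp (-r * j) := by
    refine IsBigO.of_norm_le fun j => ?_
    have : -(j • D) = diagonal fun i => -(j * R i i) := by
      rw [hD, ← diagonal_smul, diagonal_neg]
      congr 1
      funext i
      simp
    rw [this, Matrix.exp_diagonal, linfty_opNorm_diagonal,
      pi_norm_le_iff_of_nonneg (Real.exp_pos _).le]
    intro i
    rw [Pi.coe_exp, ← Complex.exp_eq_exp_ℂ, Complex.norm_exp]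
    refine Real.exp_le_exp.mpr ?_
    simp
    nlinarith [hr i, (Nat.cast_nonneg j : (0 : ℝ) ≤ j)]
  have hbN : (fun j : ℕ => NormedSpace.exp (-(j • N))) =O[atTop]
      fun j : ℕ => (j : ℝ) ^ n := by
    simp only [hexpN]
    refine IsBigO.fun_sum fun p hp => ?_
    refine IsBigO.of_bound (‖(p.factorial : ℂ)⁻¹‖ * ‖N ^ p‖) ?_
    filter_upwards [eventually_ge_atTop 1] with j hj
    have hj' : (1 : ℝ) ≤ j := by exact_mod_cast hj
    rw [norm_smul, norm_mul, norm_pow, norm_neg, Complex.norm_natCast,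
      Real.norm_of_nonneg (by positivity : (0 : ℝ) ≤ (j : ℝ) ^ n)]
    have : (j : ℝ) ^ p ≤ (j : ℝ) ^ n := pow_le_pow_right₀ hj' (Finset.mem_range.mp hp).le
    calc _ = ‖(p.factorial : ℂ)⁻¹‖ * ‖N ^ p‖ * (j : ℝ) ^ p := by ring
      _ ≤ _ := by gcongr
  simp only [hsplit]
  refine (hbD.mul hbN).congr_right fun j => by ring

theorem isBigO_exp_doubling {n : ℕ} {R : Matrix (Fin n) (Fin n) ℂ}
    (hR : IsRightHalfPlaneJordan R) {r : ℝ} (hr : ∀ i, r ≤ (R i i).re) :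
      (fun k : ℕ => NormedSpace.exp (-(2 ^ (k - 1) • R))) =O[atTop]
      fun k : ℕ => Real.exp (-r * 2 ^ (k - 1)) * 2 ^ (n * k) := by
  have h2 : Tendsto (fun k : ℕ => 2 ^ (k - 1)) atTop atTop :=
    (tendsto_pow_atTop_atTop_of_one_lt one_lt_two).comp (tendsto_sub_atTop_nat 1)
  refine ((isBigO_pow_mul_exp hR hr).comp_tendsto h2).trans (IsBigO.of_norm_le fun k => ?_)
  simp only [Function.comp, Nat.cast_pow, Nat.cast_ofNat]
  rw [Real.norm_of_nonneg (by positivity), mul_comm, ← pow_mul]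
  refine mul_le_mul_of_nonneg_left (pow_le_pow_right₀ one_le_two ?_) (Real.exp_pos _).le
  rw [mul_comm n]
  exact Nat.mul_le_mul_right n (Nat.sub_le k 1)

theorem isBigO_exp_doubling_conjTranspose {n : ℕ} {R : Matrix (Fin n) (Fin n) ℂ}
    (hR : IsRightHalfPlaneJordan R) {r : ℝ} (hr : ∀ i, r ≤ (R i i).re) :
      (fun k : ℕ => (NormedSpace.exp (-(2 ^ (k - 1) • R)))ᴴ) =O[atTop]
      fun k : ℕ => Real.exp (-r * 2 ^ (k - 1)) * 2 ^ (n * k) := by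
  refine IsBigO.trans ?_ (isBigO_exp_doubling hR hr)
  let c : Matrix (Fin n) (Fin n) ℂ →L[ℝ] Matrix (Fin n) (Fin n) ℂ :=
    LinearMap.toContinuousLinearMap
      { toFun := conjTranspose
        map_add' := conjTranspose_add
        map_smul' := fun t A => by simp }
  exact c.isBigO_comp _ _

theorem tendsto_rate {r : ℝ} (hr : 0 < r) (n : ℕ) :
    Tendsto (fun k : ℕ => Real.exp (-r * 2 ^ (k - 1)) * 2 ^ (n * k)) atTop (nhds 0) := by
  have h1 := tendsto_rpow_mul_exp_neg_mul_atTop_nhds_zero n r hr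
  have h2 : Tendsto (fun k : ℕ => (2 : ℝ) ^ (k - 1)) atTop atTop :=
    (tendsto_pow_atTop_atTop_of_one_lt one_lt_two).comp (tendsto_sub_atTop_nat 1)
  have h3 := (h1.comp h2).const_mul (2 ^ n)
  rw [mul_zero] at h3
  refine h3.congr' ?_
  filter_upwards [eventually_ge_atTop 1] with k hk
  obtain ⟨k, rfl⟩ := Nat.exists_eq_add_of_le' hk
  simp only [Function.comp, Real.rpow_natCast, Nat.add_sub_cancel]
  rw [← pow_mul, mul_add_one n, pow_add, mul_comm k n]
  ring

/-- The square of the rate of the off-diagonal blocks is the rate of the diagonal blocks. This holds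
from `k = 1` on only, because of the truncated subtraction in `k - 1`. -/
theorem rate_mul_self (r : ℝ) (n : ℕ) :
    (fun k : ℕ => (Real.exp (-r * 2 ^ (k - 1)) * 2 ^ (n * k)) *
      (Real.exp (-r * 2 ^ (k - 1)) * 2 ^ (n * k))) =ᶠ[atTop]
    fun k : ℕ => Real.exp (-r * 2 ^ k) * 2 ^ (2 * n * k) := by
  filter_upwards [eventually_ge_atTop 1] with k hk
  obtain ⟨k, rfl⟩ := Nat.exists_eq_add_of_le' hk
  rw [mul_mul_mul_comm, ← Real.exp_add, ← pow_add, Nat.add_sub_cancel]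
  congr 2 <;> ring

/-- If `y = (a + x b) O(g)` and `x - x₀ = y O(g)` with `g → 0`, then `y = O(g)` and `x - x₀ = O(g²)`:
substituting one relation into the other gives `‖y‖ ≤ C g + ‖y‖ / 2` as soon as `g` is small. -/
theorem isBigO_of_coupled {𝔸 : Type*} [NormedRing 𝔸] {x y E E' : ℕ → 𝔸} {a b c d f x₀ : 𝔸}
    {g : ℕ → ℝ} (hy : ∀ᶠ k in atTop, y k = (a + x k * b) * E k * c)
    (hx : ∀ᶠ k in atTop, x k - x₀ = y k * d * E' k * f)
    (hE : E =O[atTop] g) (hE' : E' =O[atTop] g) (hg : Tendsto g atTop (nhds 0)) :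
    y =O[atTop] g ∧ (fun k => x k - x₀) =O[atTop] fun k => g k * g k := by
  have hxy : (fun k => x k - x₀) =O[atTop] fun k => ‖y k‖ * g k := by
    have h1 : (fun k => y k * d * E' k * f) =O[atTop] fun k => ‖y k‖ * g k := by
      have := ((((isBigO_refl y atTop).norm_right.mul
        (isBigO_const_const d (one_ne_zero (α := ℝ)) atTop)).mul hE').mul
        (isBigO_const_const f (one_ne_zero (α := ℝ)) atTop))
      simpa using this
    exact h1.congr' (hx.mono fun k hk => hk.symm) EventuallyEq.rfl
  have hyg : y =O[atTop] fun k => (1 + ‖x k - x₀‖) * g k := by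
    have h0 : (fun k => a + x k * b) =O[atTop] fun k => 1 + ‖x k - x₀‖ := by
      refine IsBigO.of_bound (‖a + x₀ * b‖ + ‖b‖) (Eventually.of_forall fun k => ?_)
      rw [Real.norm_of_nonneg (by positivity)]
      calc ‖a + x k * b‖ = ‖(a + x₀ * b) + (x k - x₀) * b‖ := by congr 1; noncomm_ring
        _ ≤ ‖a + x₀ * b‖ + ‖x k - x₀‖ * ‖b‖ :=
          (norm_add_le _ _).trans (by gcongr; exact norm_mul_le _ _)
        _ ≤ _ := by nlinarith [norm_nonneg (a + x₀ * b), norm_nonneg b, norm_nonneg (x k - x₀),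
            mul_nonneg (norm_nonneg (a + x₀ * b)) (norm_nonneg (x k - x₀))]
    have h1 : (fun k => (a + x k * b) * E k * c) =O[atTop]
        fun k => (1 + ‖x k - x₀‖) * g k := by
      simpa using (h0.mul hE).mul (isBigO_const_const c (one_ne_zero (α := ℝ)) atTop)
    exact h1.congr' (hy.mono fun k hk => hk.symm) EventuallyEq.rfl
  have hmain : y =O[atTop] g := by
    obtain ⟨C, hC, h1⟩ := hxy.exists_pos
    obtain ⟨B, hB, h2⟩ := hyg.exists_pos
    have hsmall : ∀ᶠ k in atTop, B * C * |g k| * |g k| ≤ 1 / 2 := by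
      have : Tendsto (fun k => B * C * |g k| * |g k|) atTop (nhds (B * C * |0| * |0|)) :=
        (hg.abs.const_mul _).mul hg.abs
      simp only [abs_zero, mul_zero] at this
      exact this.eventually (ge_mem_nhds (by norm_num))
    refine IsBigO.of_bound (2 * B) ?_
    filter_upwards [h1.bound, h2.bound, hsmall] with k k1 k2 k3
    rw [norm_mul, norm_norm, Real.norm_eq_abs] at k1
    rw [norm_mul, Real.norm_of_nonneg (by positivity), Real.norm_eq_abs] at k2
    rw [Real.norm_eq_abs]
    have k4 : ‖y k‖ ≤ B * |g k| + (B * C * |g k| * |g k|) * ‖y k‖ := by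
      calc _ ≤ _ := k2
        _ ≤ B * ((1 + C * (‖y k‖ * |g k|)) * |g k|) := by gcongr
        _ = _ := by ring
    nlinarith [mul_le_mul_of_nonneg_right k3 (norm_nonneg (y k))]
  exact ⟨hmain, hxy.trans (hmain.norm_left.mul (isBigO_refl g atTop))⟩

theorem matIsBigO_of_isBigO {n : ℕ} {F : ℕ → Matrix (Fin n) (Fin n) ℂ} {g : ℕ → ℝ}
    (h : F =O[atTop] g) : MatIsBigO F g := by
  intro i j
  exact ((LinearMap.toContinuousLinearMap (entryLinearMap ℝ ℂ i j)).isBigO_comp F atTop).trans h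

theorem matIsBigO_of_coupled {n : ℕ} {x y E E' : ℕ → Matrix (Fin n) (Fin n) ℂ}
    {a b c d f x₀ : Matrix (Fin n) (Fin n) ℂ} {g : ℕ → ℝ}
    (hy : ∀ k, 1 ≤ k → y k = (a + x k * b) * E k * c)
    (hx : ∀ k, 1 ≤ k → x k - x₀ = y k * d * E' k * f)
    (hE : E =O[atTop] g) (hE' : E' =O[atTop] g) (hg : Tendsto g atTop (nhds 0)) :
    MatIsBigO y g ∧ MatIsBigO (fun k => x k - x₀) fun k => g k * g k := by
  obtain ⟨h1, h2⟩ := isBigO_of_coupled ((eventually_ge_atTop 1).mono hy)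
    ((eventually_ge_atTop 1).mono hx) hE hE' hg
  exact ⟨matIsBigO_of_isBigO h1, matIsBigO_of_isBigO h2⟩

theorem MatIsBigO.congr_bound {n : ℕ} {F : ℕ → Matrix (Fin n) (Fin n) ℂ} {g g' : ℕ → ℝ}
    (h : MatIsBigO F g) (hg : g =ᶠ[atTop] g') : MatIsBigO F g' :=
  fun i j => (h i j).congr' EventuallyEq.rfl hg

end Norms

end SDAConv

theorem theorem4p25 (n : ℕ) (S₁ S₂ : BMat n) (X M L : ℕ → BMat n)
    -- one of the two algorithms, with its pair of symplectic matrices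
    (hSDA : (S₁ = 1 ∧ S₂ = 1 ∧ IsSDA1 M L) ∨ (S₁ = bJ n ∧ S₂ = -1 ∧ IsSDA2 M L))
    (hX : ∀ k : ℕ, 1 ≤ k → pairOf S₁ S₂ (X k) = (M k, L k))
    -- the initial pair
    (hX1 : (X 1).IsHermitian)
    (hreg : IsRegularPair (M 1) (L 1))
    (hind : IndexInftyLE (M 1) (L 1) 1)
    -- the Hamiltonian matrix and its Hamiltonian Jordan canonical form
    (H : BMat n) (hH : IsAttachedHamiltonian (M 1) (L 1) H)
    (S : BMat n) (hS : IsSymplectic S)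
    (R : Matrix (Fin n) (Fin n) ℂ) (hR : IsRightHalfPlaneJordan R)
    (hJ : S⁻¹ * H * S = Matrix.fromBlocks R 0 0 (-Rᴴ))
    -- the minimal real part of the diagonal of `R` (in particular `n ≥ 1`)
    (r : ℝ) (hr : IsLeast (Set.range fun i : Fin n => (R i i).re) r)
    -- invertibility of `𝒰_{1,-}` and `𝒰_{1,+}`, and of `W₁⁺` and `W₂⁻`
    (hUm : IsUnit (Uminus S₂ S).toRows₁)
    (hUp : IsUnit (Uplus S₁ S).toRows₁)
    (hWp : IsUnit (Wplus S₁ S (X 1)).toRows₁)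
    (hWm : IsUnit (Wminus S₂ S (X 1)).toRows₂) :
    0 < r ∧
    ((Uminus S₂ S).toRows₂ * (Uminus S₂ S).toRows₁⁻¹).IsHermitian ∧
    ((Uplus S₁ S).toRows₂ * (Uplus S₁ S).toRows₁⁻¹).IsHermitian ∧
    MatIsBigO
      (fun k => (X k).toBlocks₂₂ - (-((Uminus S₂ S).toRows₂ * (Uminus S₂ S).toRows₁⁻¹)))
      (fun k => Real.exp (-r * 2 ^ k) * 2 ^ (2 * n * k)) ∧
    MatIsBigO (fun k => (X k).toBlocks₁₂)
      (fun k => Real.exp (-r * 2 ^ (k - 1)) * 2 ^ (n * k)) ∧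
    MatIsBigO
      (fun k => (X k).toBlocks₁₁ - (Uplus S₁ S).toRows₂ * (Uplus S₁ S).toRows₁⁻¹)
      (fun k => Real.exp (-r * 2 ^ k) * 2 ^ (2 * n * k)) ∧
    MatIsBigO (fun k => (X k).toBlocks₂₁)
      (fun k => Real.exp (-r * 2 ^ (k - 1)) * 2 ^ (n * k)) := by
  have hr0 : 0 < r := by
    obtain ⟨i, rfl⟩ := hr.1
    exact hR.1 i
  have hrle : ∀ i, r ≤ (R i i).re := fun i => hr.2 ⟨i, rfl⟩
  have hSu : IsUnit S := IsUnit.of_mul_eq_one _ hS.mul_eq_one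
  have hJJ : (bJ n)ᴴ * bJ n * bJ n = bJ n := by
    rw [bJ_conjTranspose, neg_mul, bJ_mul_self, neg_neg, one_mul]
  -- Both `S₂` and `J⁻¹ S₁` preserve the form `J`.
  have hT₂ : S₂ᴴ * bJ n * S₂ = bJ n := by
    rcases hSDA with ⟨-, rfl, -⟩ | ⟨-, rfl, -⟩ <;> simp
  have hT₁ : ((bJ n)⁻¹ * S₁)ᴴ * bJ n * ((bJ n)⁻¹ * S₁) = bJ n := by
    rw [bJ_inv]
    rcases hSDA with ⟨rfl, -, -⟩ | ⟨rfl, -, -⟩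
    · simpa using hJJ
    · rw [neg_mul, bJ_mul_self]; simp
  -- `H` is invertible, so the attached Hamiltonian matrix has no zero summand.
  have hHu : IsUnit H := by
    have hHe : H = S * fromBlocks R 0 0 (-Rᴴ) * S⁻¹ := by
      have hd := (isUnit_iff_isUnit_det _).mp hSu
      rw [← hJ]
      calc H = (S * S⁻¹) * H * (S * S⁻¹) := by rw [mul_nonsing_inv _ hd, one_mul, mul_one]
        _ = _ := by simp only [mul_assoc]
    rw [hHe]
    refine (hSu.mul ?_).mul (isUnit_nonsing_inv_iff.mpr hSu)
    rw [isUnit_iff_isUnit_det, det_fromBlocks_zero₂₁]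
    refine ((isUnit_iff_isUnit_det _).mp hR.isUnit).mul ((isUnit_iff_isUnit_det _).mp ?_)
    exact hR.isUnit.star.neg
  have hpow := pair_eq_mul_pow hSDA (hX 1 le_rfl) hX1 (hH.eq_mul_exp hHu)
  obtain ⟨hHU, hHV⟩ := mul_toCols_of_conj_eq hSu hJ
  have hE := isBigO_exp_doubling hR hrle
  have hEH := isBigO_exp_doubling_conjTranspose hR hrle
  have hg := tendsto_rate hr0 n
  have hm := fun k (hk : 1 ≤ k) => by
    obtain ⟨hM, hL⟩ := Prod.ext_iff.mp (hX k hk)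
    simp only [pairOf] at hM hL
    refine graph_relations (A := (X k).toBlocks₁₂) (B := (X k).toBlocks₁₁)
      (C := (X k).toBlocks₂₂) (D := (X k).toBlocks₂₁) (P := Uminus S₂ S) (Q := S₁ * S.toCols₂)
      (F := (NormedSpace.exp (-(2 ^ (k - 1) • R)))ᴴ) ?_ hUm
    rw [Uminus, ← Matrix.mul_assoc, hM, ← Matrix.mul_assoc, hL, hpow k hk, Matrix.mul_assoc,
      exp_pow_mul_of_stable hHV, Matrix.mul_assoc]
  have hp := fun k (hk : 1 ≤ k) => by
    obtain ⟨hM, hL⟩ := Prod.ext_iff.mp (hX k hk)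
    simp only [pairOf] at hM hL
    refine dual_graph_relations (A := (X k).toBlocks₁₂) (B := (X k).toBlocks₁₁)
      (C := (X k).toBlocks₂₂) (D := (X k).toBlocks₂₁) (Y := Uplus S₁ S) (Z := S₂ * S.toCols₁)
      (F := NormedSpace.exp (-(2 ^ (k - 1) • R))) ?_ hUp
    have hJY : bJ n * Uplus S₁ S = S₁ * S.toCols₁ := by
      rw [Uplus, bJ_inv, neg_mul, Matrix.neg_mul, Matrix.mul_neg, ← Matrix.mul_assoc,
        ← mul_assoc, bJ_mul_self]
      simp
    rw [hJY, ← Matrix.mul_assoc, hM, ← Matrix.mul_assoc, hL, hpow k hk, Matrix.mul_assoc (L k),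
      Matrix.mul_assoc (L k), exp_pow_mul_of_unstable hHU]
  obtain ⟨h12, h11⟩ := matIsBigO_of_coupled (fun k hk => (hm k hk).1)
    (fun k hk => (hp k hk).2) hEH hE hg
  obtain ⟨h21, h22⟩ := matIsBigO_of_coupled (fun k hk => (hp k hk).1)
    (fun k hk => (hm k hk).2) hE hEH hg
  refine ⟨hr0, isHermitian_mul_inv_of_isotropic (isotropic_mul hT₂ hS.isotropic_toCols₂) hUm,
    isHermitian_mul_inv_of_isotropic (isotropic_mul hT₁ hS.isotropic_toCols₁) hUp,
    h22.congr_bound (rate_mul_self r n), h12,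
    h11.congr_bound (rate_mul_self r n), h21⟩
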